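/- Let $\kappa\in\mathbb{R}$ and, for $u\in(0,1)$, let $$g_{2}^{(\kappa)}(u):=\kappa\bigl(u\log u+(1-u)\log(1-u)\bigr)\begin{pmatrix}2\\ 1/3\end{pmatrix}+\begin{pmatrix}1\\ u(1-u)\end{pmatrix}.$$ Let $(X,Y)$ be an $\mathbb{R}^2$-valued random vector that solves the bivariate Quicksort fixed-point equation $$\begin{pmatrix}X\\Y\end{pmatrix}\stackrel{d}{=}U\begin{pmatrix}X^{(1)}\\Y^{(1)}\end{pmatrix}+(1-U)\begin{pmatrix}X^{(2)}\\Y^{(2)}\end{pmatrix}+g_2^{(\kappa)}(U),$$ where $\stackrel{d}{=}$ denotes equality in distribution, $(X^{(1)},Y^{(1)})$, $(X^{(2)},Y^{(2)})$ and $U$ are independent, $(X^{(1)},Y^{(1)})$ and $(X^{(2)},Y^{(2)})$ have the same distribution as $(X,Y)$, and $U$ is uniformly distributed on $(0,1)$. No moment assumption is made on $(X,Y)$. Then $(X,Y)$ admits, with respect to Lebesgue measure on $\mathbb{R}^2$, a bounded density $f\in\mathcal{C}^\infty(\mathbb{R}^2)$. For $\kappa=1$ this is the fixed-point equation of the joint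 limit law of the rescaled numbers of key comparisons and key exchanges of Quicksort; $\kappa=2$ gives the toll $(2u\log u+2(1-u)\log(1-u))(2,1/3)^T+(1,u(1-u))^T$. -/

import Mathlib

open MeasureTheory ProbabilityTheory
open scoped ContDiff

noncomputable section

/-- The plane with its Euclidean norm, inner product and Lebesgue measure. -/
abbrev Plane : Type := EuclideanSpace ℝ (Fin 2)

/-- The bivariate Quicksort toll function
`κ (u log u + (1 - u) log (1 - u)) (2, 1/3) + (1, u (1 - u))`.
The value `κ = 1` is the toll of the limit law of key comparisons and key exchanges (both
coordinates then have mean zero under the uniform law, and the first one is the classical toll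
`2 u log u + 2 (1 - u) log (1 - u) + 1`); the value `κ = 2` is the variant
`(2 u log u + 2 (1 - u) log (1 - u)) (2, 1/3) + (1, u (1 - u))`. -/
def bivariateToll (κ u : ℝ) : Plane :=
  (κ * (u * Real.log u + (1 - u) * Real.log (1 - u))) • !₂[2, 1 / 3] + !₂[1, u * (1 - u)]

/-- The random vector `Z = (X, Y)` solves the fixed-point equation
`Z =ᵈ U Z₁ + (1 - U) Z₂ + bivariateToll κ U`, where `Z₁`, `Z₂`, `U` are defined on a possibly
different probability space.  The two independence fields together say that `Z₁`, `Z₂`, `U` are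
mutually independent. -/
structure SolvesBivariateQuicksort (κ : ℝ) {Ω Ω' : Type*} [MeasurableSpace Ω] [MeasurableSpace Ω']
    (P : Measure Ω) (P' : Measure Ω') (Z : Ω → Plane) (Z₁ Z₂ : Ω' → Plane) (U : Ω' → ℝ) :
    Prop where
  identDistrib_fst : IdentDistrib Z₁ Z P' P
  identDistrib_snd : IdentDistrib Z₂ Z P' P
  uniform : pdf.IsUniform U (Set.Ioo 0 1) P' volume
  indep_copies : IndepFun Z₁ Z₂ P'
  indep_uniform : IndepFun (fun w => (Z₁ w, Z₂ w)) U P'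
  equation : IdentDistrib Z
    (fun w => U w • Z₁ w + (1 - U w) • Z₂ w + bivariateToll κ (U w)) P P'

end

-- Everything rests on the decay of the characteristic function φ of the law of (X, Y).
-- Conditionally on the two copies, the exponent at ξ is, up to a term free of `U`, α U plus a
-- combination of entropy and U(1 - U) with coefficients K = κ(2ξ₀ + ξ₁/3) and B = ξ₁. The copies
-- enter only through α, which the second derivative in u does not see. So, without any moments, a
-- van der Corput argument bounds |φ| by a constant below 1 once |K| + |B| is large
-- (`norm_integral_cexp_tollPhase_le`). For κ ≠ 0 this covers all large ξ. For κ = 0 the directions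
-- with ξ₁ bounded remain; there α itself is large with positive probability, since X is not
-- degenerate (`IsQuicksortFixedPoint.measure_fst_ne`).
--
-- Conditioning on `U` instead gives |φ(ξ)| ≤ ∫ |φ(uξ)| |φ((1 - u)ξ)| du, which amplifies a bound
-- below 1 near infinity into decay faster than any power (`exists_polynomial_decay`). Fourier
-- inversion then yields the smooth bounded density.

-- Fourier inversion for probability measures

section Density

open Filter Module
open scoped Topology FourierTransform RealInnerProductSpace

variable {V : Type*} [NormedAddCommGroup V] [InnerProductSpace ℝ V]

/-- The Gaussian approximate identity. -/
noncomputable def gaussianKernel (c : ℝ) (v : V) : ℝ :=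
  (Real.pi * c) ^ (finrank ℝ V / 2 : ℝ) * Real.exp (-(Real.pi ^ 2 * c) * ‖v‖ ^ 2)

theorem continuous_gaussianKernel (c : ℝ) : Continuous (gaussianKernel c : V → ℝ) := by
  unfold gaussianKernel; fun_prop

theorem gaussianKernel_nonneg {c : ℝ} (hc : 0 < c) (v : V) : 0 ≤ gaussianKernel c v := by
  unfold gaussianKernel; positivity

variable [MeasurableSpace V]

/-- The Fourier transform of a measure, normalised as Mathlib's `𝓕`. -/
noncomputable def measureFourier (μ : Measure V) (w : V) : ℂ := charFun μ (-(2 * Real.pi) • w)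

theorem measureFourier_eq_fourierIntegral (μ : Measure V) :
    measureFourier μ = VectorFourier.fourierIntegral Real.fourierChar μ (innerₗ V) 1 := by
  ext w
  rw [measureFourier, charFun_eq_fourierIntegral', smul_smul]
  congr 1
  have : -(2 * Real.pi)⁻¹ * -(2 * Real.pi) = 1 := by field_simp
  rw [this, one_smul]

variable [BorelSpace V] [FiniteDimensional ℝ V]

theorem integral_gaussianKernel {c : ℝ} (hc : 0 < c) : ∫ v : V, gaussianKernel c v = 1 := by
  unfold gaussianKernel
  rw [integral_const_mul, GaussianFourier.integral_rexp_neg_mul_sq_norm (by positivity),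
    ← Real.mul_rpow (by positivity) (by positivity)]
  have : Real.pi * c * (Real.pi / (Real.pi ^ 2 * c)) = 1 := by field_simp
  rw [this, Real.one_rpow]

theorem lintegral_gaussianKernel {c : ℝ} (hc : 0 < c) :
    ∫⁻ v : V, ENNReal.ofReal (gaussianKernel c v) = 1 := by
  rw [← ofReal_integral_eq_lintegral_ofReal, integral_gaussianKernel hc, ENNReal.ofReal_one]
  · by_contra h
    have := integral_gaussianKernel (V := V) hc
    rw [integral_undef h] at this
    exact zero_ne_one this
  · exact ae_of_all _ (gaussianKernel_nonneg hc)

/-- A Gaussian damping factor in the inversion integral disappears as c → ∞; for fixed c, Fubini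
moves the Fourier transform onto the Gaussian and produces the kernel. -/
theorem tendsto_integral_gaussianKernel (μ : Measure V) [IsFiniteMeasure μ]
    (h : Integrable (measureFourier μ)) (x : V) :
    Tendsto (fun c : ℝ => ((∫ y, gaussianKernel c (x - y) ∂μ : ℝ) : ℂ)) atTop
      (𝓝 (𝓕⁻ (measureFourier μ) x)) := by
  have A : Tendsto (fun c : ℝ ↦ ∫ w : V,
      Complex.exp (- c⁻¹ * ‖w‖ ^ 2 + 2 * Real.pi * Complex.I * ⟪x, w⟫) • measureFourier μ w)
      atTop (𝓝 (𝓕⁻ (measureFourier μ) x)) := by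
    have : Integrable (fun w ↦ Real.fourierChar ⟪w, x⟫ • measureFourier μ w) := by
      have B : Continuous fun p : V × V => (- innerₗ V) p.1 p.2 := continuous_inner.neg
      simpa using!
        (VectorFourier.fourierIntegral_convergent_iff Real.continuous_fourierChar B x).2 h
    convert! Real.tendsto_integral_cexp_sq_smul this using 4 with c w
    · rw [Circle.smul_def, Real.fourierChar_apply, smul_smul, ← Complex.exp_add, real_inner_comm]
      congr 3
      simp only [Complex.ofReal_mul, Complex.ofReal_ofNat]
      ring
    · simp [Real.fourierInv_eq]
  refine A.congr' ?_
  filter_upwards [Ioi_mem_atTop 0] with c (hc : 0 < c)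
  have J : Integrable (fun w : V ↦
      Complex.exp (- c⁻¹ * ‖w‖ ^ 2 + 2 * Real.pi * Complex.I * ⟪x, w⟫)) := by
    have := GaussianFourier.integrable_cexp_neg_mul_sq_norm_add (V := V) (b := (c⁻¹ : ℝ))
      (by simpa) (2 * Real.pi * Complex.I) x
    simpa using this
  have K := VectorFourier.integral_fourierIntegral_smul_eq_flip (L := innerₗ V) (μ := μ)
      (ν := volume) (f := 1) Real.continuous_fourierChar continuous_inner (integrable_const _) J
  rw [← measureFourier_eq_fourierIntegral] at K
  simp only [smul_eq_mul] at K ⊢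
  simp_rw [mul_comm _ (measureFourier μ _)]
  rw [K, ← integral_complex_ofReal]
  congr with y
  rw [Pi.one_apply, one_mul]
  have G := fourier_gaussian_innerProductSpace' (V := V) (b := (c⁻¹ : ℝ)) (by simpa) x y
  have e : VectorFourier.fourierIntegral Real.fourierChar volume (innerₗ V).flip
      (fun w : V ↦ Complex.exp (- (c⁻¹ : ℝ) * ‖w‖ ^ 2 + 2 * Real.pi * Complex.I * ⟪x, w⟫)) y
      = 𝓕 (fun w : V ↦ Complex.exp
        (- (c⁻¹ : ℝ) * ‖w‖ ^ 2 + 2 * Real.pi * Complex.I * ⟪x, w⟫)) y := by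
    rw [flip_innerₗ]; rfl
  rw [e, G, gaussianKernel]
  push_cast
  rw [Complex.ofReal_cpow (by positivity)]
  push_cast
  congr 2
  · simp
  · simp; ring

/-- The candidate density is the inverse transform of Φ: smooth because Φ has all moments,
nonnegative as a limit of Gaussian averages of μ, integrable by Fatou. It is identified with μ by
comparing characteristic functions. -/
theorem exists_smooth_density_of_charFun_decay (μ : Measure V) [IsProbabilityMeasure μ]
    (h : ∀ k : ℕ, ∃ C : ℝ, ∀ t : V, ‖t‖ ^ k * ‖charFun μ t‖ ≤ C) :
    ∃ f : V → ℝ, ContDiff ℝ ∞ f ∧ (∃ C : ℝ, ∀ x, |f x| ≤ C) ∧ (∀ x, 0 ≤ f x) ∧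
      μ = volume.withDensity (fun x => ENNReal.ofReal (f x)) := by
  set Φ := measureFourier μ with hΦ
  have hcont : Continuous Φ := by
    rw [hΦ]; unfold measureFourier
    exact continuous_charFun.comp (by fun_prop)
  have hmom (k : ℕ) : Integrable (fun v ↦ ‖v‖ ^ k * ‖Φ v‖) := by
    -- One more than the dimension, so that (1 + ‖w‖)⁻ⁿ is integrable and can dominate.
    set n : ℕ := finrank ℝ V + 1
    have hn : (finrank ℝ V : ℝ) < (n : ℝ) := by simp [n]
    have hb : ∀ k : ℕ, ∃ C : ℝ, ∀ w : V, ‖w‖ ^ k * ‖Φ w‖ ≤ C := by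
      intro k
      obtain ⟨C, hC⟩ := h k
      refine ⟨C, fun w => le_trans ?_ (hC (-(2 * Real.pi) • w))⟩
      rw [hΦ, measureFourier]
      gcongr
      rw [norm_smul, norm_neg, Real.norm_of_nonneg (by positivity)]
      have := Real.pi_gt_three
      nlinarith [norm_nonneg w]
    obtain ⟨C₁, h₁⟩ := hb k
    obtain ⟨C₂, h₂⟩ := hb (k + n)
    refine ((integrable_one_add_norm (μ := (volume : Measure V)) hn).const_mul
      (2 ^ (n - 1) * (C₁ + C₂))).mono' (by fun_prop) (ae_of_all _ fun w => ?_)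
    have hw : 0 < 1 + ‖w‖ := by positivity
    rw [Real.rpow_neg hw.le, Real.rpow_natCast, ← div_eq_mul_inv, le_div_iff₀ (by positivity),
      Real.norm_of_nonneg (by positivity)]
    calc ‖w‖ ^ k * ‖Φ w‖ * (1 + ‖w‖) ^ n
        ≤ ‖w‖ ^ k * ‖Φ w‖ * (2 ^ (n - 1) * (1 ^ n + ‖w‖ ^ n)) := by
          gcongr
          exact add_pow_le zero_le_one (norm_nonneg _) n
      _ = 2 ^ (n - 1) * (‖w‖ ^ k * ‖Φ w‖ + ‖w‖ ^ (k + n) * ‖Φ w‖) := by ring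
      _ ≤ 2 ^ (n - 1) * (C₁ + C₂) := by
          gcongr
          exacts [h₁ w, h₂ w]
  have hint : Integrable Φ := by
    have := hmom 0
    simp only [pow_zero, one_mul] at this
    exact (integrable_norm_iff hcont.aestronglyMeasurable).1 this
  have hsmooth : ContDiff ℝ ∞ (𝓕⁻ Φ) := by
    have : ContDiff ℝ ∞ (𝓕 Φ) := Real.contDiff_fourier (fun n _ => hmom n)
    have e : 𝓕⁻ Φ = 𝓕 Φ ∘ Neg.neg := by
      ext w; exact Real.fourierInv_eq_fourier_neg Φ w
    rw [e]
    exact this.comp contDiff_neg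
  set F : V → ℝ := fun x => (𝓕⁻ Φ x).re with hF
  have hFs : ContDiff ℝ ∞ F := Complex.reCLM.contDiff.comp hsmooth
  have hlim (x : V) := tendsto_integral_gaussianKernel μ hint x
  have hre (x : V) : Tendsto (fun c : ℝ => ∫ y, gaussianKernel c (x - y) ∂μ) atTop (𝓝 (F x)) := by
    simpa using! (Complex.continuous_re.tendsto _).comp (hlim x)
  have him (x : V) : 𝓕⁻ Φ x = (F x : ℂ) := by
    refine tendsto_nhds_unique (hlim x) ?_
    exact (Complex.continuous_ofReal.tendsto _).comp (hre x)
  have hnn (x : V) : 0 ≤ F x := by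
    refine ge_of_tendsto (hre x) ?_
    filter_upwards [Ioi_mem_atTop 0] with c (hc : 0 < c)
    exact integral_nonneg fun y => gaussianKernel_nonneg hc _
  have hkint {c : ℝ} (hc : 0 < c) (x : V) : Integrable (fun y => gaussianKernel c (x - y)) μ := by
    refine Integrable.of_bound (C := (Real.pi * c) ^ (finrank ℝ V / 2 : ℝ))
      ((continuous_gaussianKernel c).comp (by fun_prop)).aestronglyMeasurable
      (ae_of_all _ fun y => ?_)
    rw [Real.norm_of_nonneg (gaussianKernel_nonneg hc _)]
    refine mul_le_of_le_one_right (by positivity) (Real.exp_le_one_iff.2 ?_)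
    have : 0 ≤ Real.pi ^ 2 * c * ‖x - y‖ ^ 2 := by positivity
    linarith
  -- Fatou: each Gaussian average of μ has total mass 1.
  have hlint : ∫⁻ x, ENNReal.ofReal (F x) ≤ 1 := by
    have hseq (x : V) : Tendsto (fun n : ℕ => ∫⁻ y, ENNReal.ofReal
        (gaussianKernel ((n : ℝ) + 1) (x - y)) ∂μ) atTop (𝓝 (ENNReal.ofReal (F x))) := by
      have h1 : Tendsto (fun n : ℕ => (n : ℝ) + 1) atTop atTop :=
        tendsto_atTop_add_const_right _ _ tendsto_natCast_atTop_atTop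
      have := (ENNReal.continuous_ofReal.tendsto _).comp ((hre x).comp h1)
      refine this.congr fun n => ?_
      have hn : (0 : ℝ) < (n : ℝ) + 1 := by positivity
      simp only [Function.comp]
      exact ofReal_integral_eq_lintegral_ofReal (hkint hn x)
        (ae_of_all _ fun y => gaussianKernel_nonneg hn _)
    have hm (n : ℕ) : Measurable (Function.uncurry fun x y : V => ENNReal.ofReal
        (gaussianKernel ((n : ℝ) + 1) (x - y))) :=
      (((continuous_gaussianKernel _).comp (by fun_prop)).measurable).ennreal_ofReal
    calc ∫⁻ x, ENNReal.ofReal (F x)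
        = ∫⁻ x, liminf (fun n : ℕ => ∫⁻ y, ENNReal.ofReal
          (gaussianKernel ((n : ℝ) + 1) (x - y)) ∂μ) atTop :=
          lintegral_congr fun x => (hseq x).liminf_eq.symm
      _ ≤ liminf (fun n : ℕ => ∫⁻ x, ∫⁻ y, ENNReal.ofReal
          (gaussianKernel ((n : ℝ) + 1) (x - y)) ∂μ) atTop :=
          lintegral_liminf_le fun n => (hm n).lintegral_prod_right'
      _ = liminf (fun n : ℕ => (1 : ENNReal)) atTop := by
          congr with n
          rw [lintegral_lintegral_swap (hm n).aemeasurable]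
          have (y : V) : ∫⁻ x, ENNReal.ofReal (gaussianKernel ((n : ℝ) + 1) (x - y)) = 1 := by
            rw [lintegral_sub_right_eq_self
              (fun x : V => ENNReal.ofReal (gaussianKernel ((n : ℝ) + 1) x)) y]
            exact lintegral_gaussianKernel (by positivity)
          simp [this]
      _ = 1 := by simp
  have hFint : Integrable F :=
    ⟨hFs.continuous.aestronglyMeasurable, by
      rw [hasFiniteIntegral_iff_ofReal (ae_of_all _ hnn)]
      exact hlint.trans_lt ENNReal.one_lt_top⟩
  have hfF : 𝓕⁻ Φ = fun x => (F x : ℂ) := funext him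
  have hinv : 𝓕 (𝓕⁻ Φ) = Φ := by
    refine hcont.fourier_fourierInv_eq hint ?_
    have : Integrable (𝓕⁻ Φ) := by rw [hfF]; exact hFint.ofReal
    have e : 𝓕 Φ = fun x => 𝓕⁻ Φ (-x) := by
      ext w; rw [Real.fourierInv_eq_fourier_neg, neg_neg]
    rw [e]
    exact this.comp_neg
  refine ⟨F, hFs, ⟨∫ v, ‖Φ v‖, fun x => ?_⟩, hnn, ?_⟩
  · refine (Complex.abs_re_le_norm _).trans ?_
    rw [Real.fourierInv_eq_fourier_neg]
    exact VectorFourier.norm_fourierIntegral_le_integral_norm _ _ _ _ _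
  · have : IsFiniteMeasure (volume.withDensity fun x => ENNReal.ofReal (F x)) :=
      isFiniteMeasure_withDensity_ofReal hFint.2
    refine Measure.ext_of_charFun (funext fun t => ?_)
    obtain ⟨w, rfl⟩ : ∃ w : V, t = -(2 * Real.pi) • w :=
      ⟨(-(2 * Real.pi))⁻¹ • t, by rw [smul_smul, mul_inv_cancel₀ (by simp [Real.pi_ne_zero]),
        one_smul]⟩
    change Φ w = measureFourier _ w
    rw [← hinv, hfF, measureFourier_eq_fourierIntegral, Real.fourier_eq,
      VectorFourier.fourierIntegral,
      integral_withDensity_eq_integral_toReal_smul (hFs.continuous.measurable.ennreal_ofReal)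
        (ae_of_all _ fun _ => ENNReal.ofReal_lt_top)]
    congr with v
    rw [ENNReal.toReal_ofReal (hnn v)]
    simp [Circle.smul_def, mul_comm]

end Density

-- Oscillatory integrals with the toll as phase

section Oscillatory

open Set

/-- First derivative test for oscillatory integrals with convex phase. -/
theorem norm_integral_cexp_le_of_le_abs_deriv {h h' h'' : ℝ → ℝ} {a b m : ℝ} (hab : a ≤ b)
    (hm : 0 < m) (hd : ∀ u ∈ Icc a b, HasDerivAt h (h' u) u)
    (hd' : ∀ u ∈ Icc a b, HasDerivAt h' (h'' u) u) (hc : ContinuousOn h'' (Icc a b))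
    (hpos : ∀ u ∈ Icc a b, 0 ≤ h'' u) (hle : ∀ u ∈ Icc a b, m ≤ |h' u|) :
    ‖∫ u in a..b, Complex.exp (Complex.I * h u)‖ ≤ 4 / m := by
  have hne : ∀ u ∈ Icc a b, h' u ≠ 0 := fun u hu h0 => by
    have := hle u hu
    rw [h0, abs_zero] at this
    linarith
  have hcc : ContinuousOn h (Icc a b) := fun u hu => (hd u hu).continuousAt.continuousWithinAt
  have hcc' : ContinuousOn h' (Icc a b) := fun u hu => (hd' u hu).continuousAt.continuousWithinAt
  have hcE : ContinuousOn (fun u => Complex.exp (Complex.I * h u)) (Icc a b) := by fun_prop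
  have hneC : ∀ u ∈ Icc a b, Complex.I * (h' u : ℂ) ≠ 0 := fun u hu =>
    mul_ne_zero Complex.I_ne_zero (by exact_mod_cast hne u hu)
  have hcQ : ContinuousOn (fun u => h'' u / h' u ^ 2) (Icc a b) :=
    hc.div (hcc'.pow 2) fun u hu => pow_ne_zero 2 (hne u hu)
  have hcR : ContinuousOn (fun u => Complex.exp (Complex.I * h u) *
      (Complex.I * ((h'' u / h' u ^ 2 : ℝ) : ℂ))) (Icc a b) :=
    hcE.mul (continuousOn_const.mul (Complex.continuous_ofReal.comp_continuousOn hcQ))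
  rw [← uIcc_of_le hab] at hcE hcQ hcR
  -- Integration by parts. By convexity the remainder has modulus h''/h'², the derivative of -1/h',
  -- so only four boundary terms of size at most 1/m survive.
  have hP : ∀ u ∈ uIcc a b, HasDerivAt
      (fun u => Complex.exp (Complex.I * h u) * (Complex.I * (h' u : ℂ))⁻¹)
      (Complex.exp (Complex.I * h u) + Complex.exp (Complex.I * h u) *
        (Complex.I * ((h'' u / h' u ^ 2 : ℝ) : ℂ))) u := by
    intro u hu
    rw [uIcc_of_le hab] at hu
    have h1 : HasDerivAt (fun u => Complex.I * (h u : ℂ)) (Complex.I * (h' u : ℂ)) u :=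
      ((hd u hu).ofReal_comp).const_mul _
    have h2 : HasDerivAt (fun u => Complex.I * (h' u : ℂ)) (Complex.I * (h'' u : ℂ)) u :=
      ((hd' u hu).ofReal_comp).const_mul _
    refine (h1.cexp.mul (h2.inv (hneC u hu))).congr_deriv ?_
    have h3 : (h' u : ℂ) ≠ 0 := by exact_mod_cast hne u hu
    simp only [Pi.inv_apply]
    push_cast
    field_simp
    linear_combination -(h'' u : ℂ) * Complex.I_mul_I
  have hQ : ∀ u ∈ uIcc a b, HasDerivAt (fun u => -(h' u)⁻¹) (h'' u / h' u ^ 2) u := by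
    intro u hu
    rw [uIcc_of_le hab] at hu
    refine ((hd' u hu).inv (hne u hu)).neg.congr_deriv ?_
    ring
  have hFTC := intervalIntegral.integral_eq_sub_of_hasDerivAt hP
    ((hcE.add hcR).intervalIntegrable)
  have hFTC' := intervalIntegral.integral_eq_sub_of_hasDerivAt hQ hcQ.intervalIntegrable
  rw [intervalIntegral.integral_add hcE.intervalIntegrable hcR.intervalIntegrable] at hFTC
  have hR : ‖∫ u in a..b, Complex.exp (Complex.I * h u) *
      (Complex.I * ((h'' u / h' u ^ 2 : ℝ) : ℂ))‖ ≤ ∫ u in a..b, h'' u / h' u ^ 2 := by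
    refine intervalIntegral.norm_integral_le_of_norm_le hab ?_ hcQ.intervalIntegrable
    filter_upwards with u hu
    have hu' : u ∈ Icc a b := ⟨hu.1.le, hu.2⟩
    rw [norm_mul, norm_mul, mul_comm Complex.I, Complex.norm_exp_ofReal_mul_I, Complex.norm_I,
      Complex.norm_real, Real.norm_of_nonneg (div_nonneg (hpos u hu') (sq_nonneg _))]
    simp
  have hend : ∀ u ∈ Icc a b, |(h' u)⁻¹| ≤ 1 / m := fun u hu => by
    rw [abs_inv, ← one_div]
    exact one_div_le_one_div_of_le hm (hle u hu)
  have hend' : ∀ u ∈ Icc a b,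
      ‖Complex.exp (Complex.I * h u) * (Complex.I * (h' u : ℂ))⁻¹‖ ≤ 1 / m := fun u hu => by
    rw [norm_mul, mul_comm Complex.I, Complex.norm_exp_ofReal_mul_I, norm_inv, norm_mul,
      Complex.norm_I, Complex.norm_real, Real.norm_eq_abs, one_mul, one_mul, ← abs_inv]
    exact hend u hu
  have ha := left_mem_Icc.2 hab
  have hb := right_mem_Icc.2 hab
  have e4 : 4 / m = 1 / m + 1 / m + (1 / m + 1 / m) := by ring
  rw [eq_sub_of_add_eq hFTC, e4]
  refine (norm_sub_le _ _).trans (add_le_add ((norm_sub_le _ _).trans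
    (add_le_add (hend' b hb) (hend' a ha))) (hR.trans ?_))
  rw [hFTC']
  have := abs_le.1 (hend a ha)
  have := abs_le.1 (hend b hb)
  linarith

/-- A convex phase with large second derivative oscillates on a quarter of the interval. -/
theorem exists_norm_integral_cexp_le {h h' h'' : ℝ → ℝ} {a b l : ℝ} (hab : a < b)
    (hl : 0 < l) (hd : ∀ u ∈ Icc a b, HasDerivAt h (h' u) u)
    (hd' : ∀ u ∈ Icc a b, HasDerivAt h' (h'' u) u) (hc : ContinuousOn h'' (Icc a b))
    (hle : ∀ u ∈ Icc a b, l ≤ h'' u) :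
    ∃ a' b', a ≤ a' ∧ b' ≤ b ∧ b' - a' = (b - a) / 4 ∧
      ‖∫ u in a'..b', Complex.exp (Complex.I * h u)‖ ≤ 16 / (l * (b - a)) := by
  have hcc' : ContinuousOn h' (Icc a b) := fun u hu => (hd' u hu).continuousAt.continuousWithinAt
  have hgrow : ∀ x ∈ Icc a b, ∀ y ∈ Icc a b, x ≤ y → l * (y - x) ≤ h' y - h' x := by
    intro x hx y hy hxy
    refine (convex_Icc a b).mul_sub_le_image_sub_of_le_deriv hcc' ?_ ?_ x hx y hy hxy
    · exact fun u hu => (hd' u (interior_subset hu)).differentiableAt.differentiableWithinAt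
    · exact fun u hu => by rw [(hd' u (interior_subset hu)).deriv]; exact hle u (interior_subset hu)
  have hm : 0 < l * (b - a) / 4 := by
    have := sub_pos.2 hab
    positivity
  have e16 : 16 / (l * (b - a)) = 4 / (l * (b - a) / 4) := by
    have := (sub_pos.2 hab).ne'
    field_simp
    norm_num
  have hmid : (a + b) / 2 ∈ Icc a b := ⟨by linarith, by linarith⟩
  rw [e16]
  -- h' grows at rate at least l, so on the outer quarter on the side given by its sign at the
  -- midpoint, |h'| ≥ l (b - a) / 4.
  rcases le_total 0 (h' ((a + b) / 2)) with h0 | h0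
  · have hs : Icc ((a + 3 * b) / 4) b ⊆ Icc a b := Icc_subset_Icc (by linarith) le_rfl
    refine ⟨(a + 3 * b) / 4, b, by linarith, le_rfl, by ring, ?_⟩
    refine norm_integral_cexp_le_of_le_abs_deriv (by linarith) hm (fun u hu => hd u (hs hu))
      (fun u hu => hd' u (hs hu)) (hc.mono hs) (fun u hu => hl.le.trans (hle u (hs hu)))
      fun u hu => ?_
    have := hgrow _ hmid u (hs hu) (by linarith [hu.1])
    refine le_trans ?_ (le_abs_self _)
    nlinarith [hu.1]
  · have hs : Icc a ((3 * a + b) / 4) ⊆ Icc a b := Icc_subset_Icc le_rfl (by linarith)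
    refine ⟨a, (3 * a + b) / 4, le_rfl, by linarith, by ring, ?_⟩
    refine norm_integral_cexp_le_of_le_abs_deriv (by linarith) hm (fun u hu => hd u (hs hu))
      (fun u hu => hd' u (hs hu)) (hc.mono hs) (fun u hu => hl.le.trans (hle u (hs hu)))
      fun u hu => ?_
    have := hgrow u (hs hu) _ hmid (by linarith [hu.2])
    refine le_trans ?_ (neg_le_abs _)
    nlinarith [hu.2]

theorem norm_integral_cexp_le_of_subinterval {h : ℝ → ℝ} (hh : Measurable h) {a b : ℝ}
    (ha : 0 ≤ a) (hb : b ≤ 1) :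
    ‖∫ u in (0 : ℝ)..1, Complex.exp (Complex.I * h u)‖ ≤
      1 - (b - a) + ‖∫ u in a..b, Complex.exp (Complex.I * h u)‖ := by
  have hn : ∀ u, ‖Complex.exp (Complex.I * h u)‖ ≤ 1 := fun u => by
    rw [mul_comm, Complex.norm_exp_ofReal_mul_I]
  have hi : ∀ x y : ℝ, IntervalIntegrable (fun u => Complex.exp (Complex.I * h u)) volume x y := by
    intro x y
    refine (intervalIntegrable_const (c := (1 : ℝ))).mono_fun'
      (Measurable.aestronglyMeasurable (by fun_prop)) (ae_of_all _ hn)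
  rw [← intervalIntegral.integral_add_adjacent_intervals (hi 0 a) (hi a 1),
    ← intervalIntegral.integral_add_adjacent_intervals (hi a b) (hi b 1)]
  have h1 := intervalIntegral.norm_integral_le_of_norm_le_const (a := 0) (b := a)
    (f := fun u => Complex.exp (Complex.I * h u)) (C := 1) fun u _ => hn u
  have h2 := intervalIntegral.norm_integral_le_of_norm_le_const (a := b) (b := 1)
    (f := fun u => Complex.exp (Complex.I * h u)) (C := 1) fun u _ => hn u
  rw [sub_zero, abs_of_nonneg ha, one_mul] at h1
  rw [abs_of_nonneg (by linarith), one_mul] at h2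
  refine (norm_add_le _ _).trans ?_
  have := norm_add_le (∫ u in a..b, Complex.exp (Complex.I * h u))
    (∫ u in b..1, Complex.exp (Complex.I * h u))
  linarith

theorem norm_integral_cexp_neg (h : ℝ → ℝ) (a b : ℝ) :
    ‖∫ u in a..b, Complex.exp (Complex.I * ((-h u : ℝ) : ℂ))‖ =
      ‖∫ u in a..b, Complex.exp (Complex.I * h u)‖ := by
  rw [← RCLike.norm_conj]
  simp only [intervalIntegral, map_sub, ← integral_conj, ← Complex.exp_conj]
  simp

/-- The phase `α u + K (u log u + (1 - u) log (1 - u)) + B u (1 - u)`. -/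
noncomputable def tollPhase (α K B u : ℝ) : ℝ :=
  α * u + K * (u * Real.log u + (1 - u) * Real.log (1 - u)) + B * (u * (1 - u))

theorem measurable_tollPhase (α K B : ℝ) : Measurable (tollPhase α K B) := by
  unfold tollPhase; fun_prop

theorem hasDerivAt_tollPhase (α K B : ℝ) {u : ℝ} (h0 : 0 < u) (h1 : u < 1) :
    HasDerivAt (tollPhase α K B)
      (α + K * (Real.log u - Real.log (1 - u)) + B * (1 - 2 * u)) u := by
  have hs : HasDerivAt (fun u : ℝ => 1 - u) (-1) u := by
    simpa using (hasDerivAt_id u).const_sub 1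
  have hl := (hasDerivAt_id u).mul (Real.hasDerivAt_log h0.ne')
  have hr := hs.mul (hs.log (sub_pos.2 h1).ne')
  have hq := (hasDerivAt_id u).mul hs
  refine ((((hasDerivAt_id u).const_mul α).add ((hl.add hr).const_mul K)).add
    (hq.const_mul B)).congr_deriv ?_
  have := (sub_pos.2 h1).ne'
  simp only [id]
  field_simp
  ring

theorem hasDerivAt_deriv_tollPhase (α K B : ℝ) {u : ℝ} (h0 : 0 < u) (h1 : u < 1) :
    HasDerivAt (fun u => α + K * (Real.log u - Real.log (1 - u)) + B * (1 - 2 * u))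
      (K / (u * (1 - u)) - 2 * B) u := by
  have hs : HasDerivAt (fun u : ℝ => 1 - u) (-1) u := by
    simpa using (hasDerivAt_id u).const_sub 1
  have hl := Real.hasDerivAt_log h0.ne'
  have hr := hs.log (sub_pos.2 h1).ne'
  have hq := ((hasDerivAt_id u).const_mul 2).const_sub 1
  refine ((((hl.sub hr).const_mul K).const_add α).add (hq.const_mul B)).congr_deriv ?_
  have := (sub_pos.2 h1).ne'
  field_simp
  ring

/-- The second derivative of the phase is large, with a constant sign, on one of two intervals. -/
theorem exists_interval_le_deriv2_tollPhase {K B : ℝ} (h : 0 ≤ K - 2 * B * (29 / 200)) :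
    ∃ a b : ℝ, 0 < a ∧ b < 1 ∧ b - a = 1 / 16 ∧
      ∀ u ∈ Icc a b, (|K| + |B|) / 5 ≤ K / (u * (1 - u)) - 2 * B := by
  have key : ∀ u : ℝ, 0 < u → u < 1 → (|K| + |B|) / 20 ≤ K - 2 * B * (u * (1 - u)) →
      (|K| + |B|) / 5 ≤ K / (u * (1 - u)) - 2 * B := by
    intro u h0 h1 hu
    have hs : 0 < u * (1 - u) := mul_pos h0 (sub_pos.2 h1)
    have hs4 : u * (1 - u) ≤ 1 / 4 := by nlinarith [sq_nonneg (u - 1 / 2)]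
    have e : K / (u * (1 - u)) - 2 * B = (K - 2 * B * (u * (1 - u))) / (u * (1 - u)) := by
      rw [sub_div, mul_div_cancel_right₀ _ hs.ne']
    rw [e, le_div_iff₀ hs]
    have : 0 ≤ |K| + |B| := by positivity
    nlinarith
  -- K - 2Bs is affine in s = u(1 - u) and nonnegative at s = 29/200, the midpoint of 11/100 and
  -- 18/100. Moving s to the side favoured by the sign of B gains at least 7/100 |B|.
  rcases le_total 0 B with hB | hB
  · refine ⟨1 / 16, 1 / 8, by norm_num, by norm_num, by norm_num, fun u hu => ?_⟩
    refine key u (by linarith [hu.1]) (by linarith [hu.2]) ?_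
    have hs : u * (1 - u) ≤ 11 / 100 := by nlinarith [hu.1, hu.2]
    have hK : |K| ≤ K - 2 * B * (29 / 200) + 29 / 100 * B := by
      rw [abs_of_nonneg (by linarith)]; linarith
    rw [abs_of_nonneg hB]
    nlinarith
  · refine ⟨1 / 4, 5 / 16, by norm_num, by norm_num, by norm_num, fun u hu => ?_⟩
    refine key u (by linarith [hu.1]) (by linarith [hu.2]) ?_
    have hs : 18 / 100 ≤ u * (1 - u) := by nlinarith [hu.1, hu.2]
    have hK : |K| ≤ K - 2 * B * (29 / 200) - 29 / 100 * B := by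
      rw [abs_le]; constructor <;> linarith
    rw [abs_of_nonpos hB]
    nlinarith

/-- The bound is uniform in α because only the second derivative is used. An interval of length 1/64
contributes at most 1280/(|K| + |B|) ≤ 1/128 instead of 1/64, which fixes both constants. -/
theorem norm_integral_cexp_tollPhase_le (α : ℝ) {K B : ℝ} (hr : 163840 ≤ |K| + |B|) :
    ‖∫ u in (0 : ℝ)..1, Complex.exp (Complex.I * tollPhase α K B u)‖ ≤ 127 / 128 := by
  wlog h : 0 ≤ K - 2 * B * (29 / 200) generalizing α K B
  · have := this (-α) (K := -K) (B := -B) (by simpa using hr) (by linarith)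
    rw [← norm_integral_cexp_neg]
    convert this using 7 with u
    simp only [tollPhase]
    ring
  obtain ⟨a, b, ha, hb, hab, hle⟩ := exists_interval_le_deriv2_tollPhase h
  have hin : ∀ u ∈ Icc a b, 0 < u ∧ u < 1 := fun u hu => ⟨ha.trans_le hu.1, hu.2.trans_lt hb⟩
  obtain ⟨a', b', ha', hb', hab', hbd⟩ := exists_norm_integral_cexp_le
    (l := (|K| + |B|) / 5) (by linarith) (by linarith)
    (fun u hu => hasDerivAt_tollPhase α K B (hin u hu).1 (hin u hu).2)
    (fun u hu => hasDerivAt_deriv_tollPhase α K B (hin u hu).1 (hin u hu).2)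
    (ContinuousOn.sub (continuousOn_const.div (by fun_prop) fun u hu =>
      (mul_pos (hin u hu).1 (sub_pos.2 (hin u hu).2)).ne') continuousOn_const) hle
  refine (norm_integral_cexp_le_of_subinterval (measurable_tollPhase α K B) (a := a') (b := b')
    (by linarith) (by linarith)).trans ?_
  rw [hab] at hab' hbd
  rw [hab']
  have : 16 / ((|K| + |B|) / 5 * (1 / 16)) ≤ 1 / 128 := by
    rw [div_le_div_iff₀ (by linarith) (by norm_num)]
    linarith
  linarith

/-- Decay of the purely quadratic phase in its linear coefficient. -/
theorem norm_integral_cexp_quadratic_le {α B m : ℝ} (hm : 0 < m) (h : m + |B| ≤ |α|) :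
    ‖∫ u in (0 : ℝ)..1, Complex.exp (Complex.I * tollPhase α 0 B u)‖ ≤ 4 / m := by
  -- Conjugation flips the phase; B ≤ 0 makes it convex.
  wlog hB : B ≤ 0 generalizing α B
  · have := this (α := -α) (B := -B) (by simpa using h) (by linarith)
    rw [← norm_integral_cexp_neg]
    convert this using 7 with u
    simp only [tollPhase]
    ring
  have e : tollPhase α 0 B = fun u => α * u + B * (u * (1 - u)) := by
    ext u; simp [tollPhase]
  rw [e]
  refine norm_integral_cexp_le_of_le_abs_deriv (h' := fun u => α + B * (1 - 2 * u))
    (h'' := fun _ => -2 * B) zero_le_one hm (fun u _ => ?_) (fun u _ => ?_) continuousOn_const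
    (fun u _ => by linarith) fun u hu => ?_
  · have hs : HasDerivAt (fun u : ℝ => 1 - u) (-1) u := by
      simpa using (hasDerivAt_id u).const_sub 1
    refine (((hasDerivAt_id u).const_mul α).add
      (((hasDerivAt_id u).mul hs).const_mul B)).congr_deriv ?_
    simp only [id]
    ring
  · have hq := ((hasDerivAt_id u).const_mul 2).const_sub 1
    refine ((hq.const_mul B).const_add α).congr_deriv ?_
    ring
  · have h1 : |B * (1 - 2 * u)| ≤ |B| := by
      rw [abs_mul]
      refine mul_le_of_le_one_right (abs_nonneg _) (abs_le.2 ⟨?_, ?_⟩) <;> linarith [hu.1, hu.2]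
    have h2 := abs_sub_abs_le_abs_sub α (-(B * (1 - 2 * u)))
    rw [abs_neg, sub_neg_eq_add] at h2
    linarith

end Oscillatory

-- From a bound below 1 to rapid decay

section Decay

open Set

variable {V : Type*} [NormedAddCommGroup V] [NormedSpace ℝ V] {φ : V → ℝ}

theorem le_two_mul_integral_half (hc : Continuous φ)
    (hrec : ∀ ξ, φ ξ ≤ ∫ u in (0 : ℝ)..1, φ (u • ξ) * φ ((1 - u) • ξ)) (ξ : V) :
    φ ξ ≤ 2 * ∫ u in (0 : ℝ)..(1 / 2), φ (u • ξ) * φ ((1 - u) • ξ) := by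
  have hcc : Continuous fun u : ℝ => φ (u • ξ) * φ ((1 - u) • ξ) := by fun_prop
  have h1 := intervalIntegral.integral_add_adjacent_intervals
    (hcc.intervalIntegrable (μ := volume) 0 (1 / 2)) (hcc.intervalIntegrable (1 / 2) 1)
  have h2 := intervalIntegral.integral_comp_sub_left (a := 0) (b := 1 / 2)
    (fun u : ℝ => φ (u • ξ) * φ ((1 - u) • ξ)) 1
  simp only [sub_sub_cancel, sub_zero] at h2
  rw [show (1 : ℝ) - 1 / 2 = 1 / 2 by norm_num] at h2
  rw [show (fun u : ℝ => φ ((1 - u) • ξ) * φ (u • ξ)) = fun u => φ (u • ξ) * φ ((1 - u) • ξ) from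
    funext fun _ => mul_comm _ _] at h2
  linarith [hrec ξ]

/-- By symmetry take u ≤ 1/2: then (1 - u)ξ has norm at least ‖ξ‖/2, giving the factor q, while
φ(uξ) is at most η except for u < R/‖ξ‖, where it is at most 1. -/
theorem le_mul_of_half_bound (hc : Continuous φ) (h0 : ∀ ξ, 0 ≤ φ ξ) (h1 : ∀ ξ, φ ξ ≤ 1)
    (hrec : ∀ ξ, φ ξ ≤ ∫ u in (0 : ℝ)..1, φ (u • ξ) * φ ((1 - u) • ξ))
    {η R q : ℝ} (hη : 0 ≤ η) (hR : 0 < R) (hq : 0 ≤ q) (hb : ∀ ξ, R ≤ ‖ξ‖ → φ ξ ≤ η) {ξ : V}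
    (hξ : 2 * R ≤ ‖ξ‖) (hqb : ∀ ζ, ‖ξ‖ / 2 ≤ ‖ζ‖ → φ ζ ≤ q) :
    φ ξ ≤ q * (η + 2 * (R / ‖ξ‖)) := by
  have hξ0 : 0 < ‖ξ‖ := by linarith
  have hcc : Continuous fun u : ℝ => φ (u • ξ) * φ ((1 - u) • ξ) := by fun_prop
  set d := R / ‖ξ‖ with hd
  have hd0 : 0 < d := by positivity
  have hd2 : d ≤ 1 / 2 := by rw [hd, div_le_div_iff₀ hξ0 two_pos]; linarith
  have hsnd : ∀ u : ℝ, u ≤ 1 / 2 → φ ((1 - u) • ξ) ≤ q := fun u hu => by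
    refine hqb _ ?_
    rw [norm_smul, Real.norm_of_nonneg (by linarith)]
    nlinarith
  have i1 : ∫ u in (0 : ℝ)..d, φ (u • ξ) * φ ((1 - u) • ξ) ≤ q * d := by
    have := intervalIntegral.integral_mono_on (μ := volume) hd0.le (hcc.intervalIntegrable 0 d)
      (intervalIntegrable_const (c := q)) fun u hu => by
        have := mul_le_mul (h1 (u • ξ)) (hsnd u (hu.2.trans hd2)) (h0 _) zero_le_one
        simpa using this
    simpa [mul_comm] using this
  have i2 : ∫ u in d..(1 / 2), φ (u • ξ) * φ ((1 - u) • ξ) ≤ η * q * (1 / 2 - d) := by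
    have := intervalIntegral.integral_mono_on (μ := volume) hd2 (hcc.intervalIntegrable d (1 / 2))
      (intervalIntegrable_const (c := η * q)) fun u hu => by
        refine mul_le_mul (hb _ ?_) (hsnd u hu.2) (h0 _) hη
        rw [norm_smul, Real.norm_of_nonneg (hd0.le.trans hu.1)]
        calc R = d * ‖ξ‖ := by rw [hd, div_mul_cancel₀ _ hξ0.ne']
          _ ≤ u * ‖ξ‖ := by gcongr; exact hu.1
    rw [intervalIntegral.integral_const, smul_eq_mul] at this
    linarith
  have h2 := le_two_mul_integral_half hc hrec ξ
  rw [← intervalIntegral.integral_add_adjacent_intervals (hcc.intervalIntegrable 0 d)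
    (hcc.intervalIntegrable d (1 / 2))] at h2
  have : 0 ≤ η * q * d := by positivity
  nlinarith

theorem exists_geometric_decay (hc : Continuous φ) (h0 : ∀ ξ, 0 ≤ φ ξ) (h1 : ∀ ξ, φ ξ ≤ 1)
    (hrec : ∀ ξ, φ ξ ≤ ∫ u in (0 : ℝ)..1, φ (u • ξ) * φ ((1 - u) • ξ))
    {η η' R : ℝ} (hη : 0 ≤ η) (hηη' : η < η') (hb : ∀ ξ, R ≤ ‖ξ‖ → φ ξ ≤ η) :
    ∃ R' > 0, ∀ (n : ℕ) (ξ : V), 2 ^ n * R' ≤ ‖ξ‖ → φ ξ ≤ η' ^ n := by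
  wlog hR : 0 < R generalizing R
  · exact this (R := 1) (fun ξ hξ => hb ξ (by linarith)) one_pos
  have hs : 0 < η' - η := sub_pos.2 hηη'
  -- Beyond this radius the error 2R/‖ξ‖ fits into η' - η, so each doubling of ‖ξ‖ gains a factor
  -- η'.
  refine ⟨max (2 * R) (2 * R / (η' - η)), lt_max_of_lt_left (by linarith), fun n => ?_⟩
  induction n with
  | zero => intro ξ _; simpa using h1 ξ
  | succ n ih =>
    intro ξ hξ
    set M := max (2 * R) (2 * R / (η' - η)) with hM
    have hM1 : 2 * R ≤ M := le_max_left _ _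
    have hM2 : 2 * R / (η' - η) ≤ M := le_max_right _ _
    have hMξ : M ≤ ‖ξ‖ := by
      refine le_trans ?_ hξ
      exact le_mul_of_one_le_left (by linarith) (one_le_pow₀ one_le_two)
    have hξ0 : 0 < ‖ξ‖ := by linarith
    have key := le_mul_of_half_bound hc h0 h1 hrec hη hR (q := η' ^ n)
      (pow_nonneg (by linarith) n) hb (hM1.trans hMξ) fun ζ hζ => ih ζ (by
        rw [pow_succ] at hξ; linarith)
    refine key.trans ?_
    rw [pow_succ]
    refine mul_le_mul_of_nonneg_left ?_ (pow_nonneg (by linarith) n)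
    have : 2 * (R / ‖ξ‖) ≤ η' - η := by
      rw [← mul_div_assoc, div_le_iff₀ hξ0, ← div_le_iff₀' hs]
      exact hM2.trans hMξ
    linarith

/-- Geometric decay is used twice: first to push φ below 2^(-(k+1)) far out, then, restarted from
that bound, to gain 2^(-k) per doubling of ‖ξ‖, which is decay of order k. -/
theorem exists_polynomial_decay (hc : Continuous φ) (h0 : ∀ ξ, 0 ≤ φ ξ) (h1 : ∀ ξ, φ ξ ≤ 1)
    (hrec : ∀ ξ, φ ξ ≤ ∫ u in (0 : ℝ)..1, φ (u • ξ) * φ ((1 - u) • ξ))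
    {η R : ℝ} (hη : η < 1) (hb : ∀ ξ, R ≤ ‖ξ‖ → φ ξ ≤ η) (k : ℕ) :
    ∃ C : ℝ, ∀ ξ, ‖ξ‖ ^ k * φ ξ ≤ C := by
  wlog hη0 : 0 ≤ η generalizing η
  · exact this (η := 0) one_pos (fun ξ hξ => (hb ξ hξ).trans (by linarith)) le_rfl
  obtain ⟨R₁, hR₁, hb₁⟩ := exists_geometric_decay hc h0 h1 hrec hη0
    (η' := (η + 1) / 2) (by linarith) hb
  obtain ⟨n, hn⟩ := exists_pow_lt_of_lt_one (show (0 : ℝ) < (1 / 2) ^ (k + 1) by positivity)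
    (show (η + 1) / 2 < 1 by linarith)
  obtain ⟨R₂, hR₂, hb₂⟩ := exists_geometric_decay hc h0 h1 hrec (η := (1 / 2) ^ (k + 1))
    (η' := (1 / 2) ^ k) (R := 2 ^ n * R₁) (by positivity)
    (pow_lt_pow_right_of_lt_one₀ (by norm_num) (by norm_num) (Nat.lt_succ_self k))
    fun ξ hξ => (hb₁ n ξ hξ).trans hn.le
  refine ⟨(2 * R₂) ^ k, fun ξ => ?_⟩
  rcases lt_or_ge ‖ξ‖ R₂ with hξ | hξ
  · calc ‖ξ‖ ^ k * φ ξ ≤ (2 * R₂) ^ k * 1 :=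
        mul_le_mul (by gcongr; linarith) (h1 ξ) (h0 ξ) (by positivity)
      _ = _ := mul_one _
  · obtain ⟨m, hm, hm'⟩ := exists_nat_pow_near ((one_le_div hR₂).2 hξ) (one_lt_two (α := ℝ))
    rw [le_div_iff₀ hR₂] at hm
    rw [div_lt_iff₀ hR₂] at hm'
    calc ‖ξ‖ ^ k * φ ξ ≤ (2 ^ (m + 1) * R₂) ^ k * ((1 / 2) ^ k) ^ m :=
        mul_le_mul (by gcongr) (hb₂ m ξ hm) (h0 ξ) (by positivity)
      _ = (2 * R₂) ^ k * ((2 ^ m) ^ k * ((1 / 2) ^ k) ^ m) := by ring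
      _ = (2 * R₂) ^ k := by
        rw [← pow_mul, ← pow_mul, mul_comm k m, ← mul_pow]
        norm_num

end Decay

-- The fixed-point equation on the Fourier side

section Quicksort

open Set
open scoped RealInnerProductSpace

/-- The right-hand side of the fixed-point equation as a function of `((z₁, z₂), u)`. -/
noncomputable def quicksortMap (κ : ℝ) (p : (Plane × Plane) × ℝ) : Plane :=
  p.2 • p.1.1 + (1 - p.2) • p.1.2 + bivariateToll κ p.2

theorem measurable_bivariateToll (κ : ℝ) : Measurable (bivariateToll κ) := by
  unfold bivariateToll
  refine Measurable.add (Measurable.smul_const (by fun_prop) _) ?_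
  refine (WithLp.measurable_toLp 2 _).comp (measurable_pi_lambda _ fun i => ?_)
  fin_cases i
  · exact measurable_const
  · exact measurable_id.mul (measurable_const.sub measurable_id)

theorem measurable_quicksortMap (κ : ℝ) : Measurable (quicksortMap κ) := by
  have := measurable_bivariateToll κ
  unfold quicksortMap
  fun_prop

/-- The law of `Z` is a fixed point of the Quicksort map. -/
def IsQuicksortFixedPoint (κ : ℝ) (μ : Measure Plane) : Prop :=
  μ = ((μ.prod μ).prod (volume.restrict (Ioc (0 : ℝ) 1))).map (quicksortMap κ)

theorem SolvesBivariateQuicksort.isQuicksortFixedPoint {κ : ℝ} {Ω Ω' : Type*} [MeasurableSpace Ω]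
    [MeasurableSpace Ω'] {P : Measure Ω} {P' : Measure Ω'} [IsProbabilityMeasure P']
    {Z : Ω → Plane} {Z₁ Z₂ : Ω' → Plane} {U : Ω' → ℝ}
    (h : SolvesBivariateQuicksort κ P P' Z Z₁ Z₂ U) : IsQuicksortFixedPoint κ (P.map Z) := by
  have h1 := h.identDistrib_fst.aemeasurable_fst
  have h2 := h.identDistrib_snd.aemeasurable_fst
  have hU : AEMeasurable U P' := h.uniform.aemeasurable (by simp) (by simp)
  have hmapU : P'.map U = volume.restrict (Ioc (0 : ℝ) 1) := by
    rw [show P'.map U = _ from h.uniform, ProbabilityTheory.cond, Real.volume_Ioo, sub_zero,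
      ENNReal.ofReal_one, inv_one, one_smul, Measure.restrict_congr_set Ioo_ae_eq_Ioc]
  have hpair := (indepFun_iff_map_prod_eq_prod_map_map h1 h2).1 h.indep_copies
  have htriple := (indepFun_iff_map_prod_eq_prod_map_map (h1.prodMk h2) hU).1 h.indep_uniform
  rw [h.identDistrib_fst.map_eq, h.identDistrib_snd.map_eq] at hpair
  rw [hpair, hmapU] at htriple
  unfold IsQuicksortFixedPoint
  rw [← htriple, AEMeasurable.map_map_of_aemeasurable
    (measurable_quicksortMap κ).aemeasurable ((h1.prodMk h2).prodMk hU)]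
  exact h.equation.map_eq

theorem inner_quicksortMap (κ : ℝ) (z : Plane × Plane) (u : ℝ) (ξ : Plane) :
    ⟪quicksortMap κ (z, u), ξ⟫ =
      tollPhase ⟪z.1 - z.2, ξ⟫ (κ * (2 * ξ 0 + ξ 1 / 3)) (ξ 1) u + (⟪z.2, ξ⟫ + ξ 0) := by
  simp [quicksortMap, bivariateToll, tollPhase, PiLp.inner_apply, Fin.sum_univ_two]
  ring

theorem inner_quicksortMap' (κ : ℝ) (z : Plane × Plane) (u : ℝ) (ξ : Plane) :
    ⟪quicksortMap κ (z, u), ξ⟫ =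
      ⟪z.1, u • ξ⟫ + ⟪z.2, (1 - u) • ξ⟫ + ⟪bivariateToll κ u, ξ⟫ := by
  simp only [quicksortMap, inner_add_left, inner_smul_left, inner_smul_right]
  simp

variable {κ : ℝ} {μ : Measure Plane}

theorem IsQuicksortFixedPoint.charFun_eq_integral (h : IsQuicksortFixedPoint κ μ) (ξ : Plane) :
    charFun μ ξ = ∫ p, Complex.exp (⟪quicksortMap κ p, ξ⟫ * Complex.I)
      ∂((μ.prod μ).prod (volume.restrict (Ioc (0 : ℝ) 1))) := by
  conv_lhs => rw [h, charFun_apply]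
  exact integral_map (measurable_quicksortMap κ).aemeasurable
    (Measurable.aestronglyMeasurable (by fun_prop))

variable [IsProbabilityMeasure μ]

theorem integrable_cexp_inner_quicksortMap (ξ : Plane) :
    Integrable (fun p => Complex.exp (⟪quicksortMap κ p, ξ⟫ * Complex.I))
      ((μ.prod μ).prod (volume.restrict (Ioc (0 : ℝ) 1))) := by
  have := measurable_quicksortMap κ
  refine Integrable.of_bound (C := 1) (Measurable.aestronglyMeasurable (by fun_prop))
    (ae_of_all _ fun p => ?_)
  rw [Complex.norm_exp_ofReal_mul_I]

theorem IsQuicksortFixedPoint.charFun_eq (h : IsQuicksortFixedPoint κ μ) (ξ : Plane) :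
    charFun μ ξ = ∫ z : Plane × Plane, Complex.exp ((⟪z.2, ξ⟫ + ξ 0 : ℝ) * Complex.I) *
      (∫ u in (0 : ℝ)..1, Complex.exp (Complex.I *
        tollPhase ⟪z.1 - z.2, ξ⟫ (κ * (2 * ξ 0 + ξ 1 / 3)) (ξ 1) u)) ∂(μ.prod μ) := by
  rw [h.charFun_eq_integral, integral_prod _ (integrable_cexp_inner_quicksortMap ξ)]
  congr with z
  rw [intervalIntegral.integral_of_le zero_le_one, ← integral_const_mul]
  congr with u
  rw [inner_quicksortMap, ← Complex.exp_add]
  push_cast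
  ring_nf

/-- Integrating over u first exposes the oscillation; the term free of u is unimodular. -/
theorem IsQuicksortFixedPoint.norm_charFun_le_integral (h : IsQuicksortFixedPoint κ μ)
    (ξ : Plane) :
    ‖charFun μ ξ‖ ≤ ∫ z : Plane × Plane, ‖∫ u in (0 : ℝ)..1, Complex.exp (Complex.I *
      tollPhase ⟪z.1 - z.2, ξ⟫ (κ * (2 * ξ 0 + ξ 1 / 3)) (ξ 1) u)‖ ∂(μ.prod μ) := by
  rw [h.charFun_eq]
  refine (norm_integral_le_integral_norm _).trans_eq ?_
  congr with z
  rw [norm_mul, Complex.norm_exp_ofReal_mul_I, one_mul]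

/-- Integrating over the copies first, independence factors the integrand and the toll leaves only a
unimodular factor. -/
theorem IsQuicksortFixedPoint.norm_charFun_le_integral_mul (h : IsQuicksortFixedPoint κ μ)
    (ξ : Plane) :
    ‖charFun μ ξ‖ ≤ ∫ u in (0 : ℝ)..1, ‖charFun μ (u • ξ)‖ * ‖charFun μ ((1 - u) • ξ)‖ := by
  rw [h.charFun_eq_integral, integral_prod_symm _ (integrable_cexp_inner_quicksortMap ξ),
    intervalIntegral.integral_of_le zero_le_one]
  refine (norm_integral_le_integral_norm _).trans_eq ?_
  congr with u
  have : ∀ z : Plane × Plane, Complex.exp (⟪quicksortMap κ (z, u), ξ⟫ * Complex.I) =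
      Complex.exp (⟪bivariateToll κ u, ξ⟫ * Complex.I) *
      (Complex.exp (⟪z.1, u • ξ⟫ * Complex.I) * Complex.exp (⟪z.2, (1 - u) • ξ⟫ * Complex.I)) := by
    intro z
    rw [inner_quicksortMap', ← Complex.exp_add, ← Complex.exp_add]
    push_cast
    ring_nf
  simp_rw [this]
  rw [integral_const_mul, integral_prod_mul (fun z : Plane => Complex.exp (⟪z, u • ξ⟫ * Complex.I))
    (fun z : Plane => Complex.exp (⟪z, (1 - u) • ξ⟫ * Complex.I)), norm_mul,
    Complex.norm_exp_ofReal_mul_I, one_mul, norm_mul]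
  rfl

theorem norm_integral_cexp_le_one (h : ℝ → ℝ) :
    ‖∫ u in (0 : ℝ)..1, Complex.exp (Complex.I * h u)‖ ≤ 1 := by
  have := intervalIntegral.norm_integral_le_of_norm_le_const (a := 0) (b := 1)
    (f := fun u => Complex.exp (Complex.I * h u)) (C := 1) fun u _ => by
      rw [mul_comm, Complex.norm_exp_ofReal_mul_I]
  simpa using this

theorem IsQuicksortFixedPoint.norm_charFun_le_of_large (h : IsQuicksortFixedPoint κ μ)
    {ξ : Plane} (hξ : 163840 ≤ |κ * (2 * ξ 0 + ξ 1 / 3)| + |ξ 1|) :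
    ‖charFun μ ξ‖ ≤ 127 / 128 := by
  refine (h.norm_charFun_le_integral ξ).trans ?_
  refine (integral_mono_of_nonneg (ae_of_all _ fun z => norm_nonneg _)
    (integrable_const (127 / 128 : ℝ))
    (ae_of_all _ fun z => norm_integral_cexp_tollPhase_le _ hξ)).trans ?_
  simp

theorem Plane.norm_le (ξ : Plane) : ‖ξ‖ ≤ |ξ 0| + |ξ 1| := by
  rw [EuclideanSpace.norm_eq, Fin.sum_univ_two, Real.sqrt_le_left (by positivity)]
  simp only [Real.norm_eq_abs]
  nlinarith [abs_nonneg (ξ 0), abs_nonneg (ξ 1)]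

theorem IsQuicksortFixedPoint.eventually_norm_charFun_le_of_ne_zero
    (h : IsQuicksortFixedPoint κ μ) (hκ : κ ≠ 0) :
    ∀ ξ : Plane, 163840 * (1 / (2 * |κ|) + 2) ≤ ‖ξ‖ → ‖charFun μ ξ‖ ≤ 127 / 128 := by
  intro ξ hξ
  refine h.norm_charFun_le_of_large ?_
  have hκ' : 0 < |κ| := abs_pos.2 hκ
  set K := |κ * (2 * ξ 0 + ξ 1 / 3)| with hK
  -- For κ ≠ 0 the pair of phase coefficients determines ξ, so it is large when ξ is.
  have h1 : |ξ 0| ≤ K * (1 / (2 * |κ|)) + |ξ 1| := by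
    have e : K * (1 / (2 * |κ|)) = |2 * ξ 0 + ξ 1 / 3| / 2 := by
      rw [hK, abs_mul]; field_simp
    rw [e]
    have := abs_sub_abs_le_abs_sub (2 * ξ 0) (-(ξ 1 / 3))
    rw [abs_neg, sub_neg_eq_add, abs_mul, abs_div, abs_two, abs_of_pos (three_pos (α := ℝ))] at this
    linarith [abs_nonneg (ξ 1)]
  have h2 := Plane.norm_le ξ
  have hc : 0 < 1 / (2 * |κ|) := by positivity
  set c := 1 / (2 * |κ|)
  have hK0 : 0 ≤ K := abs_nonneg _
  have : 163840 * (c + 2) ≤ (K + |ξ 1|) * (c + 2) := by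
    nlinarith [mul_nonneg hc.le (abs_nonneg (ξ 1))]
  exact le_of_mul_le_mul_right this (by linarith)

/-- Without the entropy term the first coordinate of a solution is not degenerate. -/
theorem IsQuicksortFixedPoint.measure_fst_ne (h : IsQuicksortFixedPoint 0 μ) :
    (μ.prod μ) {z | z.1 0 ≠ z.2 0} ≠ 0 := by
  intro h0
  have hae : ∀ᵐ z ∂(μ.prod μ), z.1 0 = z.2 0 := by
    rw [ae_iff]; exact h0
  -- If the copies of X agree almost surely, `U` drops out and X has the law of X + 1, which is
  -- impossible.
  have key (t : ℝ) : charFun μ (!₂[t, 0] : Plane) =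
      Complex.exp (t * Complex.I) * charFun μ (!₂[t, 0] : Plane) := by
    conv_lhs => rw [h.charFun_eq]
    have e : ∀ᵐ z : Plane × Plane ∂(μ.prod μ),
        Complex.exp ((⟪z.2, (!₂[t, 0] : Plane)⟫ + (!₂[t, 0] : Plane) 0 : ℝ) * Complex.I) *
          ∫ u in (0 : ℝ)..1, Complex.exp (Complex.I * tollPhase ⟪z.1 - z.2, (!₂[t, 0] : Plane)⟫
            (0 * (2 * (!₂[t, 0] : Plane) 0 + (!₂[t, 0] : Plane) 1 / 3)) ((!₂[t, 0] : Plane) 1) u)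
        = Complex.exp (t * Complex.I) *
          Complex.exp (⟪z.2, (!₂[t, 0] : Plane)⟫ * Complex.I) := by
      filter_upwards [hae] with z hz
      have e0 : ⟪z.1 - z.2, (!₂[t, 0] : Plane)⟫ = 0 := by
        simp [PiLp.inner_apply, Fin.sum_univ_two, hz]
      rw [e0, ← Complex.exp_add]
      simp [tollPhase]
      ring_nf
    rw [integral_congr_ae e, integral_const_mul, charFun_apply]
    congr 1
    rw [integral_fun_snd (fun z : Plane => Complex.exp (⟪z, (!₂[t, 0] : Plane)⟫ * Complex.I))]
    simp
  have hcont : Continuous fun t : ℝ => charFun μ (!₂[t, 0] : Plane) := by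
    refine continuous_charFun.comp ?_
    refine (PiLp.continuous_toLp 2 _).comp (continuous_pi fun i => ?_)
    fin_cases i
    · exact continuous_id
    · exact continuous_const
  have hz : (!₂[(0 : ℝ), 0] : Plane) = 0 := by
    ext i; fin_cases i <;> rfl
  have hev : ∀ᶠ t in nhds (0 : ℝ), charFun μ (!₂[t, 0] : Plane) ≠ 0 := by
    refine hcont.continuousAt.eventually_ne ?_
    rw [hz, charFun_zero]
    simp
  obtain ⟨ε, hε, hball⟩ := Metric.eventually_nhds_iff.1 hev
  set t := min (ε / 2) 1
  have ht0 : 0 < t := lt_min (by linarith) one_pos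
  have hne := hball (y := t) (by
    rw [Real.dist_eq, sub_zero, abs_of_pos ht0]
    exact (min_le_left _ _).trans_lt (by linarith))
  have h1 : Complex.exp (t * Complex.I) = 1 := by
    have := key t
    exact (mul_eq_right₀ hne).1 this.symm
  have h2 := congrArg Complex.im h1
  rw [Complex.exp_ofReal_mul_I_im, Complex.one_im] at h2
  have := Real.sin_pos_of_pos_of_lt_pi ht0 ((min_le_right _ _).trans_lt
    (by linarith [Real.pi_gt_three]))
  linarith

theorem IsQuicksortFixedPoint.exists_eventually_norm_charFun_le_of_zero
    (h : IsQuicksortFixedPoint 0 μ) :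
    ∃ η < 1, ∃ R : ℝ, ∀ ξ : Plane, R ≤ ‖ξ‖ → ‖charFun μ ξ‖ ≤ η := by
  obtain ⟨n, hn⟩ : ∃ n : ℕ, (μ.prod μ) {z : Plane × Plane |
      1 / ((n : ℝ) + 1) ≤ |(z.1 - z.2) 0| ∧ |(z.1 - z.2) 1| ≤ n} ≠ 0 := by
    by_contra! hall
    refine h.measure_fst_ne (measure_mono_null (fun z hz => ?_) (measure_iUnion_null hall))
    have hz' : 0 < |(z.1 - z.2) 0| := by
      rw [abs_pos]; simpa [sub_eq_zero] using hz
    obtain ⟨n₁, hn₁⟩ := exists_nat_one_div_lt hz'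
    obtain ⟨n₂, hn₂⟩ := exists_nat_ge |(z.1 - z.2) 1|
    refine mem_iUnion.2 ⟨max n₁ n₂, ?_, hn₂.trans (by simp)⟩
    refine le_trans ?_ hn₁.le
    gcongr
    exact le_max_left _ _
  set S := {z : Plane × Plane | 1 / ((n : ℝ) + 1) ≤ |(z.1 - z.2) 0| ∧ |(z.1 - z.2) 1| ≤ n}
  have hSm : MeasurableSet S := by
    have hm (i : Fin 2) : Measurable fun z : Plane × Plane => |(z.1 - z.2) i| := by fun_prop
    exact (measurableSet_le measurable_const (hm 0)).inter (measurableSet_le (hm 1) measurable_const)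
  set p := (μ.prod μ).real S
  have hp : 0 < p := ENNReal.toReal_pos hn (measure_ne_top _ _)
  -- When |ξ₁| < 163840, this radius forces |α| ≥ 8 + |B| on `S`, where the inner integral is then
  -- at most 4/8 = 1/2; off `S` it is at most 1.
  refine ⟨max (127 / 128) (1 - p / 2), max_lt (by norm_num) (by linarith),
    163840 + (8 + 163840 + 163840 * n) * (n + 1), fun ξ hξ => ?_⟩
  rcases le_or_gt 163840 |ξ 1| with hB | hB
  · exact (h.norm_charFun_le_of_large (by simpa using hB)).trans (le_max_left _ _)
  refine le_trans ?_ (le_max_right _ _)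
  have hξ0 : (8 + 163840 + 163840 * n) * ((n : ℝ) + 1) ≤ |ξ 0| := by
    linarith [Plane.norm_le ξ]
  refine (h.norm_charFun_le_integral ξ).trans ?_
  have hbound : ∀ z : Plane × Plane, ‖∫ u in (0 : ℝ)..1, Complex.exp (Complex.I *
      tollPhase ⟪z.1 - z.2, ξ⟫ (0 * (2 * ξ 0 + ξ 1 / 3)) (ξ 1) u)‖ ≤
      1 - S.indicator (fun _ => (1 / 2 : ℝ)) z := by
    intro z
    by_cases hz : z ∈ S
    · rw [indicator_of_mem hz, zero_mul]
      refine (norm_integral_cexp_quadratic_le (m := 8) (by norm_num) ?_).trans (by norm_num)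
      have e : ⟪z.1 - z.2, ξ⟫ = ξ 0 * (z.1 - z.2) 0 + ξ 1 * (z.1 - z.2) 1 := by
        simp [PiLp.inner_apply, Fin.sum_univ_two]
      rw [e]
      have h1 := abs_sub_abs_le_abs_sub (ξ 0 * (z.1 - z.2) 0) (-(ξ 1 * (z.1 - z.2) 1))
      rw [abs_neg, sub_neg_eq_add, abs_mul, abs_mul] at h1
      have h2 : |ξ 1| * |(z.1 - z.2) 1| ≤ 163840 * n :=
        mul_le_mul hB.le hz.2 (abs_nonneg _) (by norm_num)
      have h3 : 8 + 163840 + 163840 * (n : ℝ) ≤ |ξ 0| * |(z.1 - z.2) 0| := by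
        calc 8 + 163840 + 163840 * (n : ℝ)
            = (8 + 163840 + 163840 * n) * ((n : ℝ) + 1) * (1 / ((n : ℝ) + 1)) := by field_simp
          _ ≤ _ := mul_le_mul hξ0 hz.1 (by positivity) (abs_nonneg _)
      linarith
    · rw [indicator_of_notMem hz, sub_zero]
      exact norm_integral_cexp_le_one _
  have hi : Integrable (S.indicator fun _ => (1 / 2 : ℝ)) (μ.prod μ) :=
    (integrable_const _).indicator hSm
  refine (integral_mono_of_nonneg (ae_of_all _ fun z => norm_nonneg _)
    ((integrable_const 1).sub hi) (ae_of_all _ hbound)).trans_eq ?_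
  simp only [Pi.sub_apply]
  rw [integral_sub (integrable_const 1) hi, integral_indicator_const _ hSm]
  simp [p]
  ring

theorem IsQuicksortFixedPoint.exists_eventually_norm_charFun_le (h : IsQuicksortFixedPoint κ μ) :
    ∃ η < 1, ∃ R : ℝ, ∀ ξ : Plane, R ≤ ‖ξ‖ → ‖charFun μ ξ‖ ≤ η := by
  by_cases hκ : κ = 0
  · subst hκ
    exact h.exists_eventually_norm_charFun_le_of_zero
  · exact ⟨_, by norm_num, _, h.eventually_norm_charFun_le_of_ne_zero hκ⟩

end Quicksort

theorem mainTheorem6 (κ : ℝ) {Ω Ω' : Type*} [MeasurableSpace Ω] [MeasurableSpace Ω']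
    (P : Measure Ω) [IsProbabilityMeasure P] (P' : Measure Ω') [IsProbabilityMeasure P']
    (Z : Ω → Plane) (Z₁ Z₂ : Ω' → Plane) (U : Ω' → ℝ)
    (h : SolvesBivariateQuicksort κ P P' Z Z₁ Z₂ U) :
    ∃ f : Plane → ℝ, ContDiff ℝ ∞ f ∧ (∃ C : ℝ, ∀ x, |f x| ≤ C) ∧ (∀ x, 0 ≤ f x) ∧
      P.map Z = volume.withDensity (fun x => ENNReal.ofReal (f x)) := by
  have hμ := h.isQuicksortFixedPoint
  have : IsProbabilityMeasure (P.map Z) :=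
    Measure.isProbabilityMeasure_map h.equation.aemeasurable_fst
  obtain ⟨η, hη, R, hR⟩ := hμ.exists_eventually_norm_charFun_le
  exact exists_smooth_density_of_charFun_decay _ fun k =>
    exists_polynomial_decay continuous_charFun.norm (fun _ => norm_nonneg _)
      (fun _ => norm_charFun_le_one _) hμ.norm_charFun_le_integral_mul hη hR k
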